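/- Let $B$ be a real Banach space and let $\bar f : B \to B$ be a compact map, that is, $\bar f$ is continuous and, for every bounded set $A \subset B$, the image $\bar f(A)$ is relatively compact (its closure is compact). Suppose that $M \subset B$ is a nonempty, closed, convex and bounded set with $\bar f(M) \subseteq M$. Then $\bar f$ has a fixed point in $M$: there exists $\bar x \in M$ such that $\bar f(\bar x) = \bar x$. -/

import Mathlib

/-- A (nonlinear) compact map between normed spaces: a continuous map sending every bounded set
to a relatively compact set. -/
structure IsCompactMap {X Y : Type*} [NormedAddCommGroup X] [NormedAddCommGroup Y]
    (f : X → Y) : Prop where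
  continuous : Continuous f
  isCompact_closure_image : ∀ A : Set X, Bornology.IsBounded A → IsCompact (closure (f '' A))

/-! Schauder reduces to Brouwer on a simplex, and Brouwer to Scarf's parity argument on dominant
sets, which replaces Sperner's lemma and needs no triangulation. Colour each grid point of the
simplex by a coordinate that `f` does not decrease. A dominant set with all colours yields clustered
grid points; as the mesh shrinks, a limit satisfies `x i ≤ f x i` for all `i`, with equality because
both sides sum to 1. On `M`, a finite `ε`-net of `f '' M` and weights supported near `f x` transfer
the problem to a simplex. This gives `dist (f x) x < ε`, and compactness of `closure (f '' M)`
yields an exact fixed point. -/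

section Scarf

/-! ### Exchanging elements of dominant sets -/

variable {W I α : Type*} [LinearOrder α]

/-- A set `X` of alternatives is dominant for the rankings `r` if no alternative is ranked strictly
above the minimum of `X` by every ranking. -/
def ScarfDominant (r : I → W → α) (X : Finset W) : Prop :=
  ∀ y, ∃ i, ∀ x ∈ X, r i y ≤ r i x

theorem ScarfDominant.mono {r : I → W → α} {X Y : Finset W} (hX : ScarfDominant r X)
    (h : Y ⊆ X) : ScarfDominant r Y := fun y =>
  (hX y).imp fun _ hi x hx => hi x (h hx)

/-- `x` is the best alternative for `k` among those that improve on `m l` for every `l ≠ k`. -/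
def IsScarfReplacement (r : I → W → α) (m : I → W) (k : I) (x : W) : Prop :=
  (∀ l, l ≠ k → r l (m l) < r l x) ∧
    ∀ y, (∀ l, l ≠ k → r l (m l) < r l y) → r k y ≤ r k x

variable {r : I → W → α} {Y : Finset W} {m : I → W}

theorem IsScarfReplacement.unique (hr : ∀ i, Function.Injective (r i)) {k : I} {x y : W}
    (hx : IsScarfReplacement r m k x) (hy : IsScarfReplacement r m k y) : x = y :=
  hr k (le_antisymm (hy.2 x hx.1) (hx.2 y hy.1))

theorem ScarfDominant.exists_eq (hr : ∀ i, Function.Injective (r i)) (hY : ScarfDominant r Y)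
    (hmY : ∀ l, m l ∈ Y) (hm : ∀ l, ∀ x ∈ Y, r l (m l) ≤ r l x) {z : W} (hz : z ∈ Y) :
    ∃ l, z = m l := by
  obtain ⟨l, hl⟩ := hY z
  exact ⟨l, hr l (le_antisymm (hl _ (hmY l)) (hm l z hz))⟩

theorem exists_isScarfReplacement [Finite W] (k : I)
    (h : ∃ y, ∀ l, l ≠ k → r l (m l) < r l y) : ∃ x, IsScarfReplacement r m k x := by
  obtain ⟨x, hx, hmax⟩ := Set.exists_max_image {y | ∀ l, l ≠ k → r l (m l) < r l y} (r k)
    (Set.toFinite _) h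
  exact ⟨x, hx, hmax⟩

variable [Fintype I] [DecidableEq I] [DecidableEq W]

theorem card_image_erase_erase_add_two_le (m : I → W) {k l : I} (hkl : k ≠ l) :
    (((Finset.univ.erase k).erase l).image m).card + 2 ≤ Fintype.card I := by
  have h1 := Finset.card_image_le (s := (Finset.univ.erase k).erase l) (f := m)
  have h2 := Finset.card_erase_add_one (s := Finset.univ.erase k) (a := l) (by simp [hkl.symm])
  have h3 := Finset.card_erase_add_one (s := Finset.univ) (a := k) (by simp)
  rw [Finset.card_univ] at h3
  omega

/-- The repeated minimiser leaves ranking `k` free: adding `x` lowers the minimum only there, and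
maximality of `x` preserves dominance. -/
theorem IsScarfReplacement.notMem_and_dominant (hr : ∀ i, Function.Injective (r i))
    (hY : ScarfDominant r Y) (hmY : ∀ l, m l ∈ Y) (hm : ∀ l, ∀ x ∈ Y, r l (m l) ≤ r l x)
    {k k' : I} (hkk : k' ≠ k) (hmk : m k = m k') {x : W} (hx : IsScarfReplacement r m k x) :
    x ∉ Y ∧ ScarfDominant r (insert x Y) := by
  constructor
  · intro hxY
    obtain ⟨l, rfl⟩ := hY.exists_eq hr hmY hm hxY
    by_cases hl : l = k
    · subst hl
      have := hx.1 k' hkk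
      rw [hmk] at this
      exact lt_irrefl _ this
    · exact lt_irrefl _ (hx.1 l hl)
  · have hxk : r k x ≤ r k (m k) := by
      obtain ⟨l, hl⟩ := hY x
      by_cases hlk : l = k
      · subst hlk; exact hl _ (hmY l)
      · exact absurd (hl _ (hmY l)) (not_le.2 (hx.1 l hlk))
    intro y
    by_cases hy : ∀ l, l ≠ k → r l (m l) < r l y
    · refine ⟨k, fun z hz => ?_⟩
      rcases Finset.mem_insert.1 hz with rfl | hz
      · exact hx.2 y hy
      · exact ((hx.2 y hy).trans hxk).trans (hm k z hz)
    · push Not at hy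
      obtain ⟨l, hlk, hl⟩ := hy
      refine ⟨l, fun z hz => ?_⟩
      rcases Finset.mem_insert.1 hz with rfl | hz
      · exact hl.trans (hx.1 l hlk).le
      · exact hl.trans (hm l z hz)

/-- Every element of `insert x Y` is its minimum in some ranking. Counting allows `x` only one
ranking, which must be one of the two sharing a minimiser. -/
theorem ScarfDominant.exists_isScarfReplacement (hr : ∀ i, Function.Injective (r i))
    (hmY : ∀ l, m l ∈ Y) (hm : ∀ l, ∀ x ∈ Y, r l (m l) ≤ r l x)
    (hcard : Y.card + 1 = Fintype.card I) {i j : I} (hij : i ≠ j) (hmij : m i = m j)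
    {x : W} (hxY : x ∉ Y) (hx : ScarfDominant r (insert x Y)) :
    IsScarfReplacement r m i x ∨ IsScarfReplacement r m j x := by
  have key : ∀ z ∈ Y, ∃ p, z = m p ∧ ¬ r p x ≤ r p z := by
    intro z hz
    obtain ⟨p, hp⟩ := hx z
    refine ⟨p, hr p (le_antisymm (hp _ (Finset.mem_insert_of_mem (hmY p))) (hm p z hz)), ?_⟩
    intro hle
    have : x = z := hr p (le_antisymm hle (hp x (Finset.mem_insert_self _ _)))
    exact hxY (this ▸ hz)
  obtain ⟨k, hk⟩ := hx x
  have hkY : ∀ z ∈ Y, r k x ≤ r k z := fun z hz => hk z (Finset.mem_insert_of_mem hz)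
  have hxS : ∀ l, l ≠ k → r l (m l) < r l x := by
    intro l hlk
    by_contra! hle
    have hsub : Y ⊆ ((Finset.univ.erase k).erase l).image m := by
      intro z hz
      obtain ⟨p, hzp, hp⟩ := key z hz
      refine Finset.mem_image.2 ⟨p, ?_, hzp.symm⟩
      simp only [Finset.mem_erase, Finset.mem_univ, and_true]
      exact ⟨fun h => hp (h ▸ hle.trans (hm l z hz)), fun h => hp (h ▸ hkY z hz)⟩
    have h1 := Finset.card_le_card hsub
    have h2 := card_image_erase_erase_add_two_le m hlk.symm
    omega
  have hkij : k = i ∨ k = j := by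
    by_contra! hne
    have hsub : Y ⊆ ((Finset.univ.erase k).erase i).image m := by
      intro z hz
      obtain ⟨p, hzp, hp⟩ := key z hz
      have hpk : p ≠ k := fun h => hp (h ▸ hkY z hz)
      by_cases hpi : p = i
      · refine Finset.mem_image.2 ⟨j, ?_, by rw [hzp, hpi, hmij]⟩
        simp [hne.2.symm, hij.symm]
      · exact Finset.mem_image.2 ⟨p, by simp [hpi, hpk], hzp.symm⟩
    have h1 := Finset.card_le_card hsub
    have h2 := card_image_erase_erase_add_two_le m hne.1
    omega
  have : IsScarfReplacement r m k x := by
    refine ⟨hxS, fun y hy => ?_⟩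
    obtain ⟨p, hp⟩ := hx y
    by_cases hpk : p = k
    · exact hpk ▸ hp x (Finset.mem_insert_self _ _)
    · exact absurd (hp _ (Finset.mem_insert_of_mem (hmY p))) (not_le.2 (hy p hpk))
  rcases hkij with rfl | rfl
  · exact Or.inl this
  · exact Or.inr this

/-! ### Parity count of rooms and doors -/

variable [Fintype W] {s : I → W} {c : W → I}

open Classical in
/-- The dominant sets with as many elements as there are rankings. -/
noncomputable def scarfRooms (r : I → W → α) : Finset (Finset W) :=
  {X | X.card = Fintype.card I ∧ ScarfDominant r X}

open Classical in
/-- The dominant sets whose elements carry, without repetition, all colours except `i₀`. -/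
noncomputable def scarfDoors (r : I → W → α) (c : W → I) (i₀ : I) : Finset (Finset W) :=
  {Y | Y.card + 1 = Fintype.card I ∧ ScarfDominant r Y ∧ Y.image c = Finset.univ.erase i₀}

omit [DecidableEq I] [DecidableEq W] in
theorem mem_scarfRooms {X : Finset W} :
    X ∈ scarfRooms r ↔ X.card = Fintype.card I ∧ ScarfDominant r X := by
  simp [scarfRooms]

omit [DecidableEq W] in
theorem mem_scarfDoors {i₀ : I} {Y : Finset W} :
    Y ∈ scarfDoors r c i₀ ↔
      Y.card + 1 = Fintype.card I ∧ ScarfDominant r Y ∧ Y.image c = Finset.univ.erase i₀ := by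
  simp [scarfDoors]

omit [DecidableEq I] in
theorem exists_eq_insert_of_mem_scarfRooms {X : Finset W} (hX : X ∈ scarfRooms r)
    (hcard : Y.card + 1 = Fintype.card I) (hYX : Y ⊆ X) : ∃ x, x ∉ Y ∧ insert x Y = X := by
  obtain ⟨x, hx, h⟩ := (Finset.covBy_iff_exists_insert (s := Y) (t := X)).1
    (Finset.covBy_iff_card_sdiff_eq_one.2 ⟨hYX, by
      rw [Finset.card_sdiff_of_subset hYX, (mem_scarfRooms.1 hX).1]; omega⟩)
  exact ⟨x, hx, h⟩

omit [DecidableEq I] in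
theorem insert_mem_scarfRooms {x : W} (hx : x ∉ Y) (hcard : Y.card + 1 = Fintype.card I)
    (hd : ScarfDominant r (insert x Y)) : insert x Y ∈ scarfRooms r :=
  mem_scarfRooms.2 ⟨by rw [Finset.card_insert_of_notMem hx, hcard], hd⟩

omit [DecidableEq W] in
theorem injOn_of_mem_scarfDoors {i₀ : I} (hY : Y ∈ scarfDoors r c i₀) : Set.InjOn c Y := by
  obtain ⟨h1, -, h2⟩ := mem_scarfDoors.1 hY
  apply Finset.injOn_of_card_image_eq
  have := Finset.card_erase_add_one (Finset.mem_univ i₀)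
  rw [Finset.card_univ] at this
  rw [h2]
  omega

/-- If there is a door at all, the extra element repeats one of its colours; deleting either copy
gives a door, and no other deletion does. -/
theorem even_card_scarfDoors_subset {i₀ : I} {X : Finset W} (hX : X ∈ scarfRooms r)
    (hc : X.image c ≠ Finset.univ) : Even ((scarfDoors r c i₀).filter (· ⊆ X)).card := by
  rcases ((scarfDoors r c i₀).filter (· ⊆ X)).eq_empty_or_nonempty with h | ⟨Y, hY⟩
  · simp [h]
  obtain ⟨hYd, hYX⟩ := Finset.mem_filter.1 hY
  obtain ⟨hYc, -, hYi⟩ := mem_scarfDoors.1 hYd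
  obtain ⟨x, hxY, rfl⟩ := exists_eq_insert_of_mem_scarfRooms hX hYc hYX
  have hcx : c x ∈ Y.image c := by
    rw [hYi]
    refine Finset.mem_erase.2 ⟨fun h => hc ?_, Finset.mem_univ _⟩
    rw [Finset.image_insert, hYi, h, Finset.insert_erase (Finset.mem_univ _)]
  obtain ⟨x', hx'Y, hx'⟩ := Finset.mem_image.1 hcx
  have hxx' : x ≠ x' := fun h => hxY (h ▸ hx'Y)
  have : (scarfDoors r c i₀).filter (· ⊆ insert x Y) = {Y, (insert x Y).erase x'} := by
    ext Z
    simp only [Finset.mem_filter, Finset.mem_insert, Finset.mem_singleton]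
    constructor
    · rintro ⟨hZ, hZX⟩
      obtain ⟨w, hwZ, hw⟩ := exists_eq_insert_of_mem_scarfRooms hX (mem_scarfDoors.1 hZ).1 hZX
      have hZe : Z = (insert x Y).erase w := by rw [← hw, Finset.erase_insert hwZ]
      by_cases hwx : w = x
      · left; rw [hZe, hwx, Finset.erase_insert hxY]
      by_cases hwx' : w = x'
      · right; rw [hZe, hwx']
      exfalso
      refine hxx' (injOn_of_mem_scarfDoors hZ ?_ ?_ hx'.symm)
      · rw [hZe]; simp [Ne.symm hwx]
      · rw [hZe]; simp [Ne.symm hwx', hx'Y]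
    · rintro (rfl | rfl)
      · exact ⟨hYd, hYX⟩
      · refine ⟨mem_scarfDoors.2 ⟨?_, ?_, ?_⟩, Finset.erase_subset _ _⟩
        · rw [Finset.card_erase_add_one (by simp [hx'Y])]
          exact (mem_scarfRooms.1 hX).1
        · exact (mem_scarfRooms.1 hX).2.mono (Finset.erase_subset _ _)
        · rw [Finset.erase_insert_of_ne hxx', ← hYi, Finset.image_insert, ← hx',
            ← Finset.image_insert, Finset.insert_erase hx'Y]
  rw [this, Finset.card_pair]
  · exact even_two
  · intro h
    have : x' ∈ (insert x Y).erase x' := h ▸ hx'Y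
    simp at this

/-- By pigeonhole two rankings share a minimiser in `Y`; freeing one or the other gives the two
rooms. -/
theorem card_scarfRooms_superset_eq_two (hr : ∀ i, Function.Injective (r i))
    (hs : ∀ i w, r i (s i) ≤ r i w) (hs' : ∀ i j w, i ≠ j → w ∉ Set.range s → r i w < r i (s j))
    (hcs : ∀ i, c (s i) = i) {i₀ : I} (hY : Y ∈ scarfDoors r c i₀)
    (hne : Y ≠ (Finset.univ.erase i₀).image s) :
    ((scarfRooms r).filter (Y ⊆ ·)).card = 2 := by
  obtain ⟨hcard, hdom, hcol⟩ := mem_scarfDoors.1 hY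
  have hYne : Y.Nonempty := by
    rw [Finset.nonempty_iff_ne_empty]
    rintro rfl
    rw [Finset.image_empty] at hcol
    exact hne (by rw [← hcol, Finset.image_empty])
  choose m hmY hm using fun i => Y.exists_min_image (r i) hYne
  obtain ⟨i, -, j, -, hij, hmij⟩ := Finset.exists_ne_map_eq_of_card_lt_of_maps_to
    (s := Finset.univ) (t := Y) (f := m) (by rw [Finset.card_univ]; omega) (fun i _ => hmY i)
  have hsinj : Function.Injective s := fun a b h => by rw [← hcs a, h, hcs b]
  -- The slack `s k` qualifies unless some `m l` is a slack `s p` with `p ≠ l`; then `Y` consists of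
  -- the slacks other than `s l`, and its colours make it the excluded door.
  have hslack : ∀ k, ∃ y, ∀ l, l ≠ k → r l (m l) < r l y := by
    refine fun k => ⟨s k, fun l hlk => ?_⟩
    by_cases hml : m l ∈ Set.range s
    · obtain ⟨p, hp⟩ := hml
      by_cases hpl : p = l
      · subst hpl
        rw [← hp]
        exact lt_of_le_of_ne (hs _ _) fun h => hlk (hsinj (hr _ h))
      · exfalso
        have hsub : Y ⊆ (Finset.univ.erase l).image s := by
          intro y hy
          have hyr : y ∈ Set.range s := by
            by_contra hyr
            exact absurd (hm l y hy) (not_le.2 (hp ▸ hs' l p y (Ne.symm hpl) hyr))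
          obtain ⟨q, rfl⟩ := hyr
          refine Finset.mem_image_of_mem _ (Finset.mem_erase.2 ⟨?_, Finset.mem_univ _⟩)
          rintro rfl
          exact hpl (hsinj (hr q (le_antisymm (hp ▸ hm q _ hy) (hs _ _))))
        have hYe : Y = (Finset.univ.erase l).image s := by
          refine Finset.eq_of_subset_of_card_le hsub ?_
          rw [Finset.card_image_of_injective _ hsinj,
            Finset.card_erase_of_mem (Finset.mem_univ _), Finset.card_univ]
          omega
        have hl : l = i₀ := by
          by_contra hl
          have h1 : l ∈ Y.image c := by rw [hcol]; simp [hl]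
          rw [hYe, Finset.image_image] at h1
          simp [hcs] at h1
        exact hne (hl ▸ hYe)
    · exact hs' l k _ hlk hml
  obtain ⟨xi, hxi⟩ := exists_isScarfReplacement i (hslack i)
  obtain ⟨xj, hxj⟩ := exists_isScarfReplacement j (hslack j)
  obtain ⟨hxiY, hxid⟩ := hxi.notMem_and_dominant hr hdom hmY hm hij.symm hmij
  obtain ⟨hxjY, hxjd⟩ := hxj.notMem_and_dominant hr hdom hmY hm hij hmij.symm
  have hxij : xi ≠ xj := by
    rintro rfl
    obtain ⟨l, hl⟩ := hdom xi
    by_cases hli : l = i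
    · exact absurd (hl _ (hmY l)) (not_le.2 (hxj.1 l (hli ▸ hij)))
    · exact absurd (hl _ (hmY l)) (not_le.2 (hxi.1 l hli))
  have : (scarfRooms r).filter (Y ⊆ ·) = {insert xi Y, insert xj Y} := by
    ext X
    simp only [Finset.mem_filter, Finset.mem_insert, Finset.mem_singleton]
    constructor
    · rintro ⟨hX, hYX⟩
      obtain ⟨x, hxY, rfl⟩ := exists_eq_insert_of_mem_scarfRooms hX hcard hYX
      rcases ScarfDominant.exists_isScarfReplacement hr hmY hm hcard hij hmij hxY
        (mem_scarfRooms.1 hX).2 with h | h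
      · left; rw [h.unique hr hxi]
      · right; rw [h.unique hr hxj]
    · rintro (rfl | rfl)
      · exact ⟨insert_mem_scarfRooms hxiY hcard hxid, Finset.subset_insert _ _⟩
      · exact ⟨insert_mem_scarfRooms hxjY hcard hxjd, Finset.subset_insert _ _⟩
  rw [this, Finset.card_pair]
  intro h
  have : xi ∈ insert xj Y := h ▸ Finset.mem_insert_self _ _
  simp [hxij, hxiY] at this

/-- At this boundary door only ranking `i₀` is free, so the added element must be the best for `i₀`
outside the door. -/
theorem slack_mem_scarfDoors_and_card_eq_one (hr : ∀ i, Function.Injective (r i))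
    (hs : ∀ i w, r i (s i) ≤ r i w) (hs' : ∀ i j w, i ≠ j → w ∉ Set.range s → r i w < r i (s j))
    (hcs : ∀ i, c (s i) = i) (i₀ : I) :
    (Finset.univ.erase i₀).image s ∈ scarfDoors r c i₀ ∧
      ((scarfRooms r).filter ((Finset.univ.erase i₀).image s ⊆ ·)).card = 1 := by
  have hsinj : Function.Injective s := fun a b h => by rw [← hcs a, h, hcs b]
  set Y := (Finset.univ.erase i₀).image s with hYdef
  have hmem : ∀ i, i ≠ i₀ → s i ∈ Y := fun i hi => by simp [hYdef, hsinj.eq_iff, hi]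
  have hcard : Y.card + 1 = Fintype.card I := by
    rw [hYdef, Finset.card_image_of_injective _ hsinj,
      Finset.card_erase_add_one (Finset.mem_univ _), Finset.card_univ]
  have hs₀ : s i₀ ∉ Y := by simp [hYdef, hsinj.eq_iff]
  obtain ⟨x, hxY, hx⟩ := Set.exists_max_image {y | y ∉ Y} (r i₀) (Set.toFinite _) ⟨s i₀, hs₀⟩
  have hd : ScarfDominant r (insert x Y) := by
    intro y
    by_cases hy : y ∈ Y
    · obtain ⟨l, -, rfl⟩ := Finset.mem_image.1 hy
      exact ⟨l, fun z _ => hs l z⟩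
    · refine ⟨i₀, fun z hz => ?_⟩
      rcases Finset.mem_insert.1 hz with rfl | hz
      · exact hx y hy
      · obtain ⟨l, hl, rfl⟩ := Finset.mem_image.1 hz
        have hl : l ≠ i₀ := (Finset.mem_erase.1 hl).1
        by_cases hyr : y ∈ Set.range s
        · obtain ⟨p, rfl⟩ := hyr
          by_cases hp : p = i₀
          · exact hp ▸ hs _ _
          · exact absurd (hmem p hp) hy
        · exact (hs' _ _ _ hl.symm hyr).le
  refine ⟨mem_scarfDoors.2 ⟨hcard, hd.mono (Finset.subset_insert _ _), ?_⟩, ?_⟩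
  · rw [hYdef, Finset.image_image]
    rw [show c ∘ s = id from funext hcs, Finset.image_id]
  · rw [Finset.card_eq_one]
    refine ⟨insert x Y, ?_⟩
    ext X
    simp only [Finset.mem_filter, Finset.mem_singleton]
    constructor
    · rintro ⟨hX, hYX⟩
      obtain ⟨z, hzY, rfl⟩ := exists_eq_insert_of_mem_scarfRooms hX hcard hYX
      have hz : r i₀ x ≤ r i₀ z := by
        obtain ⟨l, hl⟩ := (mem_scarfRooms.1 hX).2 x
        by_cases hl₀ : l = i₀
        · exact hl₀ ▸ hl z (Finset.mem_insert_self _ _)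
        · have : x = s l := hr l (le_antisymm
            (hl _ (Finset.mem_insert_of_mem (hmem l hl₀))) (hs _ _))
          exact absurd (this ▸ hmem l hl₀) hxY
      rw [hr i₀ (le_antisymm hz (hx z hzY))]
    · rintro rfl
      exact ⟨insert_mem_scarfRooms hxY hcard hd, Finset.subset_insert _ _⟩

/-- **Scarf's lemma**: there is a dominant set carrying every colour. -/
theorem exists_scarfDominant_image_eq_univ [Nonempty I] (hr : ∀ i, Function.Injective (r i))
    (hs : ∀ i w, r i (s i) ≤ r i w) (hs' : ∀ i j w, i ≠ j → w ∉ Set.range s → r i w < r i (s j))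
    (hcs : ∀ i, c (s i) = i) :
    ∃ X : Finset W, ScarfDominant r X ∧ X.image c = Finset.univ := by
  by_contra! hno
  obtain ⟨i₀⟩ := ‹Nonempty I›
  have hcount := Finset.sum_card_bipartiteAbove_eq_sum_card_bipartiteBelow
    (s := scarfDoors r c i₀) (t := scarfRooms r) (fun Y X : Finset W => Y ⊆ X)
  have heven : Even (∑ X ∈ scarfRooms r,
      (Finset.bipartiteBelow (fun Y X : Finset W => Y ⊆ X) (scarfDoors r c i₀) X).card) :=
    Finset.even_sum _ fun X hX =>
      even_card_scarfDoors_subset hX (hno X (mem_scarfRooms.1 hX).2)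
  obtain ⟨hmem, hone⟩ := slack_mem_scarfDoors_and_card_eq_one hr hs hs' hcs i₀
  -- Counted by doors, the incidences are twos plus a single one, hence odd.
  rw [← hcount, ← Finset.add_sum_erase _ _ hmem] at heven
  have h2 : Even (∑ Y ∈ (scarfDoors r c i₀).erase ((Finset.univ.erase i₀).image s),
      (Finset.bipartiteAbove (fun Y X : Finset W => Y ⊆ X) (scarfRooms r) Y).card) := by
    refine Finset.even_sum _ fun Y hY => ?_
    have := card_scarfRooms_superset_eq_two hr hs hs' hcs (Finset.mem_erase.1 hY).2
      (Finset.mem_erase.1 hY).1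
    rw [Finset.bipartiteAbove, this]
    exact even_two
  have h1 := (Nat.even_add.1 heven).2 h2
  rw [Finset.bipartiteAbove, hone] at h1
  exact absurd h1 (by decide)

end Scarf

/-! ### Brouwer's theorem on the simplex -/

section Brouwer

open Filter Topology

variable {I : Type*} [Fintype I]

/-- The first alternative covers colours carried by a slack, whose coordinate minimum is `-1`. -/
theorem exists_close_grid_points [DecidableEq I] [Nonempty I] (N : ℕ) (c : (I → ℕ) → I) :
    ∃ z : I → ℕ, ∑ i, z i = N ∧ ∀ i, z i < Fintype.card I ∨
      ∃ x : I → ℕ, ∑ l, x l = N ∧ c x = i ∧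
        ∀ l, |(x l : ℤ) - z l| ≤ Fintype.card I := by
  classical
  let T := {x : I → ℕ // x ∈ Finset.piAntidiag Finset.univ N}
  have : Fintype T := Finset.Subtype.fintype _
  have hT : ∀ x : I → ℕ, x ∈ Finset.piAntidiag Finset.univ N ↔ ∑ i, x i = N := by simp
  -- Slack `j` lies below the grid in coordinate `j` and above it in all others. The enumeration `e`
  -- breaks ties below.
  let v : T ⊕ I → I → ℤ :=
    Sum.elim (fun x i => (x.1 i : ℤ)) (fun j i => if i = j then -1 else N + 1)
  let e := Fintype.equivFin (T ⊕ I)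
  let r : I → T ⊕ I → ℤ ×ₗ Fin (Fintype.card (T ⊕ I)) := fun i w => toLex (v w i, e w)
  have hrv : ∀ i w w', r i w ≤ r i w' → v w i ≤ v w' i := by
    intro i w w' h
    rcases Prod.Lex.toLex_le_toLex.1 h with h | h
    · exact h.le
    · exact h.1.le
  have hvr : ∀ i w w', v w i < v w' i → r i w < r i w' :=
    fun i w w' h => Prod.Lex.toLex_lt_toLex.2 (Or.inl h)
  have hr : ∀ i, Function.Injective (r i) := fun i w w' h =>
    e.injective (Prod.ext_iff.1 (toLex.injective h)).2
  have hxN : ∀ (x : T) i, x.1 i ≤ N := fun x i => by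
    refine le_of_le_of_eq ?_ ((hT _).1 x.2)
    exact Finset.single_le_sum (f := x.1) (fun _ _ => Nat.zero_le _) (Finset.mem_univ i)
  obtain ⟨X, hX, hXc⟩ := exists_scarfDominant_image_eq_univ (r := r) (s := Sum.inr)
    (c := Sum.elim (fun x => c x.1) id) hr
    (by
      intro i w
      by_cases hw : w = Sum.inr i
      · rw [hw]
      · refine (hvr _ _ _ ?_).le
        rcases w with x | j
        · simp [v]; omega
        · have : i ≠ j := fun h => hw (h ▸ rfl)
          simp [v, this])
    (by
      intro i j w hij hw
      rcases w with x | k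
      · refine hvr _ _ _ ?_
        have := hxN x i
        simp [v, hij]; omega
      · exact absurd ⟨k, rfl⟩ hw)
    (fun _ => rfl)
  have hcol : ∀ i, ∃ w ∈ X, Sum.elim (fun x : T => c x.1) id w = i := fun i =>
    Finset.mem_image.1 (by rw [hXc]; exact Finset.mem_univ i)
  obtain ⟨i₀⟩ := ‹Nonempty I›
  have hXne : X.Nonempty := let ⟨w, hw, _⟩ := hcol i₀; ⟨w, hw⟩
  choose m hmX hm using fun i => X.exists_min_image (fun w => v w i) hXne
  set a : I → ℤ := fun i => v (m i) i with ha
  have hle : ∀ i, ∀ w ∈ X, a i ≤ v w i := hm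
  have ha₁ : ∀ i, -1 ≤ a i := by
    intro i
    simp only [ha]
    rcases m i with x | j
    · simp only [v, Sum.elim_inl]; omega
    · simp only [v, Sum.elim_inr]; split_ifs <;> omega
  have hdom : ∀ y : I → ℕ, ∑ i, y i = N → ∃ i, (y i : ℤ) ≤ a i := by
    intro y hy
    obtain ⟨i, hi⟩ := hX (Sum.inl ⟨y, (hT y).2 hy⟩)
    exact ⟨i, hrv _ _ _ (hi _ (hmX i))⟩
  -- Otherwise the point `a + 1`, topped up at `i₀` to total `N`, would beat every minimum. This
  -- bound confines the grid points of `X` to a small box.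
  have hsum : (N : ℤ) < ∑ i, (a i + 1) := by
    by_contra! hlt
    set b : I → ℕ := fun i => (a i + 1).toNat with hb
    have hba : ∀ i, (b i : ℤ) = a i + 1 := fun i => Int.toNat_of_nonneg (by linarith [ha₁ i])
    have hbN : ∑ i, b i ≤ N := by
      zify
      simpa [hba] using hlt
    obtain ⟨i, hi⟩ := hdom (b + Pi.single i₀ (N - ∑ i, b i)) (by
      simp [Finset.sum_add_distrib, hbN])
    have h1 := hba i
    simp only [Pi.add_apply] at hi
    push_cast at hi
    omega
  have hclose : ∀ x : T, Sum.inl x ∈ X → ∀ i, a i ≤ x.1 i ∧ (x.1 i : ℤ) < a i + Fintype.card I := by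
    intro x hx i
    have h0 : ∀ i, a i ≤ x.1 i := fun i => hle i _ hx
    refine ⟨h0 i, ?_⟩
    have h1 : (x.1 i : ℤ) - a i ≤ ∑ l, ((x.1 l : ℤ) - a l) :=
      Finset.single_le_sum (f := fun l => (x.1 l : ℤ) - a l)
        (fun l _ => sub_nonneg.2 (h0 l)) (Finset.mem_univ i)
    have h2 : ∑ l, (x.1 l : ℤ) = N := by exact_mod_cast (hT _).1 x.2
    rw [Finset.sum_sub_distrib, h2] at h1
    rw [Finset.sum_add_distrib] at hsum
    simp at hsum
    linarith
  have hcol' : ∀ i, a i = -1 ∨ ∃ x : T, Sum.inl x ∈ X ∧ c x.1 = i := by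
    intro i
    obtain ⟨w, hw, hwi⟩ := hcol i
    rcases w with x | j
    · exact Or.inr ⟨x, hw, hwi⟩
    · left
      obtain rfl : j = i := hwi
      have := hle j _ hw
      simp [v] at this
      linarith [ha₁ j]
  obtain ⟨z, hz⟩ : ∃ z : T, Sum.inl z ∈ X := by
    obtain ⟨i, hi⟩ := hdom (Pi.single i₀ N) (by simp)
    rcases hcol' i with h | ⟨x, hx, -⟩
    · omega
    · exact ⟨x, hx⟩
  refine ⟨z.1, (hT _).1 z.2, fun i => ?_⟩
  rcases hcol' i with h | ⟨x, hx, hxi⟩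
  · left
    have := (hclose z hz i).2
    omega
  · right
    refine ⟨x.1, (hT _).1 x.2, hxi, fun l => ?_⟩
    have h1 := hclose z hz l
    have h2 := hclose x hx l
    rw [abs_le]
    constructor <;> linarith

/-- **Brouwer's fixed point theorem** for the standard simplex. -/
theorem exists_mem_stdSimplex_eq [Nonempty I] (f : (I → ℝ) → I → ℝ)
    (hf : ContinuousOn f (stdSimplex ℝ I)) (hmaps : Set.MapsTo f (stdSimplex ℝ I) (stdSimplex ℝ I)) :
    ∃ x ∈ stdSimplex ℝ I, f x = x := by
  classical
  have happrox : ∀ ε > 0, ∃ z ∈ stdSimplex ℝ I, ∀ i, z i ≤ f z i + ε := by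
    intro ε hε
    have huc := (isCompact_stdSimplex ℝ I).uniformContinuousOn_of_continuous hf
    obtain ⟨δ, hδ, hδf⟩ := Metric.uniformContinuousOn_iff.1 huc (ε / 2) (by positivity)
    obtain ⟨N, hN⟩ := exists_nat_gt (Fintype.card I / min δ (ε / 2))
    have hmin : 0 < min δ (ε / 2) := by positivity
    have hNpos : (0 : ℝ) < N := lt_of_le_of_lt (by positivity) hN
    have hNε : Fintype.card I / (N : ℝ) < min δ (ε / 2) := by
      rw [div_lt_iff₀ hmin] at hN
      rw [div_lt_iff₀ hNpos]
      linarith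
    let p : (I → ℕ) → I → ℝ := fun x i => x i / N
    have hp : ∀ x : I → ℕ, ∑ i, x i = N → p x ∈ stdSimplex ℝ I := by
      intro x hx
      refine ⟨fun i => by positivity, ?_⟩
      have : ∑ i, (x i : ℝ) = N := by exact_mod_cast hx
      simp only [p]
      rw [← Finset.sum_div, this, div_self hNpos.ne']
    -- Both points have coordinate sum 1, so not all coordinates can drop.
    have hc : ∀ x : I → ℕ, ∃ i, ∑ i, x i = N → p x i ≤ f (p x) i := by
      intro x
      by_contra! h
      obtain ⟨i₀⟩ := ‹Nonempty I›
      have hx := (h i₀).1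
      have := Finset.sum_lt_sum_of_nonempty (Finset.univ_nonempty (α := I)) fun i _ => (h i).2
      rw [(hp x hx).2, (hmaps (hp x hx)).2] at this
      exact lt_irrefl _ this
    choose c hc using hc
    obtain ⟨z, hz, hzi⟩ := exists_close_grid_points N c
    refine ⟨p z, hp z hz, fun i => ?_⟩
    rcases hzi i with h | ⟨x, hx, hxi, hxz⟩
    · have h1 : p z i ≤ Fintype.card I / (N : ℝ) := by
        simp only [p]
        gcongr
      have h2 := (hmaps (hp z hz)).1 i
      linarith [min_le_right δ (ε / 2)]
    · have hd : dist (p x) (p z) ≤ Fintype.card I / (N : ℝ) := by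
        refine (dist_pi_le_iff (by positivity)).2 fun l => ?_
        simp only [p]
        rw [Real.dist_eq, ← sub_div, abs_div, abs_of_pos hNpos]
        gcongr
        exact_mod_cast hxz l
      have h1 := hδf _ (hp x hx) _ (hp z hz) (by linarith [min_le_left δ (ε / 2)])
      have h2 := (dist_le_pi_dist (f (p x)) (f (p z)) i).trans h1.le
      have h3 := (dist_le_pi_dist (p x) (p z) i).trans hd
      have h4 := hc x hx
      rw [hxi] at h4
      rw [Real.dist_eq] at h2 h3
      have h5 := (abs_le.1 h2).2
      have h6 := (abs_le.1 h3).1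
      linarith [min_le_right δ (ε / 2)]
  choose z hz hzε using fun n : ℕ => happrox (1 / (n + 1)) (by positivity)
  obtain ⟨x, hx, φ, hφ, hlim⟩ := (isCompact_stdSimplex ℝ I).tendsto_subseq hz
  have hflim : Tendsto (fun n => f (z (φ n))) atTop (𝓝 (f x)) :=
    (hf x hx).tendsto.comp (tendsto_nhdsWithin_iff.2 ⟨hlim, Eventually.of_forall fun n => hz _⟩)
  have hle : ∀ i, x i ≤ f x i := by
    intro i
    have h0 : Tendsto (fun n => (1 : ℝ) / ((φ n : ℕ) + 1)) atTop (𝓝 0) :=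
      tendsto_one_div_add_atTop_nhds_zero_nat.comp hφ.tendsto_atTop
    have h1 := ((tendsto_pi_nhds.1 hflim i).add h0)
    rw [add_zero] at h1
    exact le_of_tendsto_of_tendsto' (tendsto_pi_nhds.1 hlim i) h1 fun n => hzε _ i
  refine ⟨x, hx, ?_⟩
  have hsum : ∑ i, x i = ∑ i, f x i := by rw [hx.2, (hmaps hx).2]
  exact funext fun i =>
    ((Finset.sum_eq_sum_iff_of_le fun i _ => hle i).1 hsum i (Finset.mem_univ i)).symm

end Brouwer

/-! ### From Brouwer to Schauder -/

section Schauder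

open Filter Topology

/-- A continuous self-map of a convex set with totally bounded image has approximate fixed points. -/
theorem exists_dist_lt_of_totallyBounded_image {E : Type*} [NormedAddCommGroup E]
    [NormedSpace ℝ E] {f : E → E} {M : Set E} (hf : ContinuousOn f M) (hM : M.Nonempty)
    (hconv : Convex ℝ M) (hfM : Set.MapsTo f M M) (htb : TotallyBounded (f '' M))
    {ε : ℝ} (hε : 0 < ε) : ∃ x ∈ M, dist (f x) x < ε := by
  obtain ⟨t, htM, htfin, ht⟩ := totallyBounded_iff_subset.1 htb _ (Metric.dist_mem_uniformity hε)
  have htc : ∀ x ∈ M, ∃ y ∈ t, dist (f x) y < ε := by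
    intro x hx
    simpa using ht (Set.mem_image_of_mem f hx)
  have : Fintype t := htfin.fintype
  have hyM : ∀ y : t, (y : E) ∈ M := fun y => by
    obtain ⟨x, hx, h⟩ := htM y.2
    exact h ▸ hfM hx
  obtain ⟨x₀, hx₀⟩ := hM
  have : Nonempty t := let ⟨y, hy, _⟩ := htc x₀ hx₀; ⟨⟨y, hy⟩⟩
  let w : t → E → ℝ := fun y x => max 0 (ε - dist x y)
  have hw₀ : ∀ y x, 0 ≤ w y x := fun y x => le_max_left _ _
  have hw₁ : ∀ y x, w y x ≠ 0 → dist x y < ε := by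
    intro y x h
    by_contra! hle
    exact h (max_eq_left (by linarith))
  have hwc : ∀ y, Continuous (w y) := fun y => by fun_prop
  have hsum : ∀ x ∈ M, 0 < ∑ y, w y (f x) := by
    intro x hx
    obtain ⟨y, hy, hd⟩ := htc x hx
    exact Finset.sum_pos' (fun y _ => hw₀ y _)
      ⟨⟨y, hy⟩, Finset.mem_univ _, lt_max_of_lt_right (by linarith)⟩
  let b : (t → ℝ) → E := fun a => ∑ y, a y • (y : E)
  have hbM : ∀ a ∈ stdSimplex ℝ t, b a ∈ M := fun a ha =>
    hconv.sum_mem (fun y _ => ha.1 y) ha.2 fun y _ => hyM y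
  have hbc : Continuous b := by fun_prop
  have hfb : ContinuousOn (fun a => f (b a)) (stdSimplex ℝ t) :=
    hf.comp hbc.continuousOn hbM
  obtain ⟨a, ha, hfix⟩ := exists_mem_stdSimplex_eq
    (fun a y => w y (f (b a)) / ∑ y', w y' (f (b a)))
    (by
      refine continuousOn_pi.2 fun y => ContinuousOn.div ((hwc y).comp_continuousOn hfb) ?_
        fun a ha => (hsum _ (hbM a ha)).ne'
      exact continuousOn_finsetSum _ fun y _ => (hwc y).comp_continuousOn hfb)
    (by
      intro a ha
      refine ⟨fun y => div_nonneg (hw₀ _ _) (hsum _ (hbM a ha)).le, ?_⟩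
      rw [← Finset.sum_div, div_self (hsum _ (hbM a ha)).ne'])
  refine ⟨b a, hbM a ha, ?_⟩
  rw [← Metric.mem_ball']
  -- At the fixed point, nonzero weights occur only at net points within `ε` of `f (b a)`, so their
  -- average `b a` lies in that ball.
  have hmem : ∑ᶠ y, a y • (y : E) ∈ Metric.ball (f (b a)) ε := by
    refine (convex_ball (f (b a)) ε).finsum_mem ha.1
      ((finsum_eq_sum_of_fintype _).trans ha.2) fun y hy => ?_
    rw [Metric.mem_ball']
    refine hw₁ y _ fun h => hy ?_
    rw [← hfix]
    simp only [h, zero_div]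
  rwa [finsum_eq_sum_of_fintype] at hmem

/-- **Schauder's fixed point theorem**. -/
theorem exists_mem_eq_of_isCompact_closure_image {E : Type*} [NormedAddCommGroup E]
    [NormedSpace ℝ E] {f : E → E} {M : Set E} (hf : ContinuousOn f M) (hM : M.Nonempty)
    (hclosed : IsClosed M) (hconv : Convex ℝ M) (hfM : Set.MapsTo f M M)
    (hcomp : IsCompact (closure (f '' M))) : ∃ x ∈ M, f x = x := by
  have htb : TotallyBounded (f '' M) := hcomp.totallyBounded.subset subset_closure
  choose x hxM hx using fun n : ℕ =>
    exists_dist_lt_of_totallyBounded_image hf hM hconv hfM htb (Nat.one_div_pos_of_nat (n := n))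
  obtain ⟨p, -, φ, hφ, hlim⟩ :=
    hcomp.tendsto_subseq fun n => subset_closure (Set.mem_image_of_mem f (hxM n))
  have hd : Tendsto (fun n => dist (f (x (φ n))) (x (φ n))) atTop (𝓝 0) :=
    squeeze_zero (fun _ => dist_nonneg) (fun n => (hx (φ n)).le)
      (tendsto_one_div_add_atTop_nhds_zero_nat.comp hφ.tendsto_atTop)
  have hxlim : Tendsto (fun n => x (φ n)) atTop (𝓝 p) := (tendsto_iff_of_dist hd).1 hlim
  have hpM : p ∈ M := hclosed.mem_of_tendsto hxlim (Eventually.of_forall fun n => hxM _)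
  refine ⟨p, hpM, tendsto_nhds_unique ?_ hlim⟩
  exact (hf p hpM).tendsto.comp
    (tendsto_nhdsWithin_iff.2 ⟨hxlim, Eventually.of_forall fun n => hxM _⟩)

end Schauder

theorem theorem4p1 {B : Type*} [NormedAddCommGroup B] [NormedSpace ℝ B] [CompleteSpace B]
    (f : B → B) (hf : IsCompactMap f)
    (M : Set B) (hM_nonempty : M.Nonempty) (hM_closed : IsClosed M) (hM_convex : Convex ℝ M)
    (hM_bounded : Bornology.IsBounded M) (hfM : f '' M ⊆ M) :
    ∃ x ∈ M, f x = x :=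
  exists_mem_eq_of_isCompact_closure_image hf.continuous.continuousOn hM_nonempty hM_closed
    hM_convex (Set.mapsTo_iff_image_subset.2 hfM) (hf.isCompact_closure_image M hM_bounded)
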